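/- For a matrix $A\in\mathbb C^{4\times4}$ let $W(A)=\{\langle Ax,x\rangle : x\in\mathbb C^4,\ \|x\|=1\}$ be its numerical range. A subset of $\mathbb C$ is called bi-elliptical if it is the convex hull of two (non-degenerate) ellipses with distinct centers, neither of which lies in the convex hull of the other; circles count as ellipses. Let $b_1,b_2\in\mathbb C$, $b\in\mathbb R$, and $$A=\begin{bmatrix}0&0&\overline{b_1}+1&0\\0&0&b&\overline{b_2}+1\\b_1-1&b&0&0\\0&b_2-1&0&0\end{bmatrix}.$$ Then $W(A)$ is bi-elliptical if and only if $b\neq0$ and at least one of the following holds: (i) $\operatorname{Im}b_1=\operatorname{Im}b_2$ and $|b_1|=|b_2|$, or (ii) $\operatorname{Re}b_1=\operatorname{Re}b_2=0$. -/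

import Mathlib

/-- The numerical range `W(A) = {⟨Ax, x⟩ : ‖x‖ = 1}` of a square complex matrix, with respect to the
standard (Euclidean) inner product.  Mathlib's inner product is conjugate-linear in its first
argument, so `inner ℂ x (A x) = ∑ i, (A x) i * conj (x i)`. -/
def numericalRange {n : Type*} [Fintype n] [DecidableEq n] (A : Matrix n n ℂ) : Set ℂ :=
  {w | ∃ x : EuclideanSpace ℂ n, ‖x‖ = 1 ∧ w = inner ℂ x (Matrix.toEuclideanLin A x)}

/-- `E` is a non-degenerate ellipse (the curve, circles included) with center `c`: for some
semi-axes `r, s > 0` and some rotation angle `φ`, it is the curve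
`c + e^{iφ} (r cos t + i s sin t)`. -/
def IsEllipseWithCenter (E : Set ℂ) (c : ℂ) : Prop :=
  ∃ r s φ : ℝ, 0 < r ∧ 0 < s ∧
    E = Set.range fun t : ℝ =>
      c + Complex.exp (φ * Complex.I) *
        ((r * Real.cos t : ℝ) + (s * Real.sin t : ℝ) * Complex.I)

/-- A planar set is bi-elliptical if it is the convex hull of two non-degenerate ellipses with
distinct centers.  Neither ellipse may lie in the convex hull of the other one: otherwise the
hull is just one elliptical disk, and every elliptical disk would qualify. -/
def IsBiElliptical (S : Set ℂ) : Prop :=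
  ∃ (E₁ E₂ : Set ℂ) (c₁ c₂ : ℂ),
    IsEllipseWithCenter E₁ c₁ ∧ IsEllipseWithCenter E₂ c₂ ∧ c₁ ≠ c₂ ∧
    ¬ E₁ ⊆ convexHull ℝ E₂ ∧ ¬ E₂ ⊆ convexHull ℝ E₁ ∧
    S = convexHull ℝ (E₁ ∪ E₂)

/-- The 4-by-4 matrix `[α I, B* + I; B - I, -α I]` with the upper triangular block
`B = [b₁, b; 0, b₂]`, where `b` is real. -/
noncomputable def triangularizedMatrix (α b₁ b₂ : ℂ) (b : ℝ) : Matrix (Fin 4) (Fin 4) ℂ :=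
  !![α, 0, (starRingEnd ℂ) b₁ + 1, 0;
     0, α, (b : ℂ), (starRingEnd ℂ) b₂ + 1;
     b₁ - 1, (b : ℂ), -α, 0;
     0, b₂ - 1, 0, -α]

/-! A compact convex planar set is determined by its support function. In direction `(x, y)` that of
`W(A)` is the largest eigenvalue of `[0, C*; C, 0]` with `C = x B + i y I`, that is, the largest
singular value of `C`: the greatest root of `m⁴ - T m² + F`, where `T`, `F` are the trace and
determinant of `C* C`. An ellipse has support function `l + √q`, with `l` linear, given by the
center, and `q` a positive definite quadratic form.

If `W(A)` is bi-elliptical, an ellipse with center off the origin and not swallowed by the other one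
supports `W(A)` in an open set of directions, so there `l + √q` is a root. As `√q` is not rational
and `l ≠ 0`, this forces `T = 2 (l² + q)` and `F = (l² - q)²` (`eq_of_infinite_kippenhahn`);
comparing coefficients gives the conditions (`conditions_of_splitting`). Conversely, such a
splitting has the roots `±l ± √q`, and the greatest, `|l| + √q`, is the support function of the hull
of two translates of one ellipse (`isBiElliptical_of_splitting`). -/

/-! ### Convexity and compactness of the numerical range -/

theorem exists_unit_mul_im_eq_zero (u : ℂ) : ∃ μ : ℂ, ‖μ‖ = 1 ∧ (μ * u).im = 0 := by
  by_cases h : u = 0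
  · exact ⟨1, by simp, by simp [h]⟩
  · refine ⟨(starRingEnd ℂ) u / ‖u‖, ?_, ?_⟩
    · have : ‖u‖ ≠ 0 := norm_ne_zero_iff.mpr h
      simp [this]
    · rw [div_mul_eq_mul_div, mul_comm, Complex.mul_conj, ← Complex.ofReal_div]
      exact Complex.ofReal_im _

/-- A value of the quadratic form, divided by the squared norm, lies in the numerical range. -/
theorem mem_numericalRange_of_inner_eq {n : Type*} [Fintype n] [DecidableEq n]
    {A : Matrix n n ℂ} {z : EuclideanSpace ℂ n} (hz : z ≠ 0) {w : ℂ}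
    (h : inner ℂ z (Matrix.toEuclideanLin A z) = w * (‖z‖ : ℂ) ^ 2) : w ∈ numericalRange A := by
  have hn : (‖z‖ : ℂ) ≠ 0 := by simpa using hz
  refine ⟨((‖z‖ : ℂ)⁻¹) • z, ?_, ?_⟩
  · rw [norm_smul]
    have : ‖z‖ ≠ 0 := norm_ne_zero_iff.mpr hz
    simp [this]
  · rw [map_smul, inner_smul_left, inner_smul_right, h]
    simp only [map_inv₀, Complex.conj_ofReal]
    field_simp

/-- The Toeplitz–Hausdorff theorem. -/
theorem convex_numericalRange {n : Type*} [Fintype n] [DecidableEq n] (A : Matrix n n ℂ) :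
    Convex ℝ (numericalRange A) := by
  rw [convex_iff_segment_subset]
  rintro w₁ ⟨x, hx, hw₁⟩ w₂ ⟨y, hy, hw₂⟩ w hw
  obtain ⟨s, ⟨hs0, hs1⟩, rfl⟩ := (segment_eq_image' ℝ w₁ w₂) ▸ hw
  by_cases hD : w₂ - w₁ = 0
  · exact ⟨x, hx, by simp [hD, ← hw₁]⟩
  set T := Matrix.toEuclideanLin A with hT
  set D := w₂ - w₁ with hDdef
  set a := (inner ℂ x (T y) - w₁ * inner ℂ x y) / D with ha
  set d := (inner ℂ y (T x) - w₁ * inner ℂ y x) / D with hd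
  -- This phase makes the cross term `μ a + conj μ d` real, so the values along `(1 - t) x + t μ y`
  -- stay on the line through `w₁` and `w₂`.
  obtain ⟨μ, hμ, him⟩ := exists_unit_mul_im_eq_zero (a - (starRingEnd ℂ) d)
  have hμ2 : (starRingEnd ℂ) μ * μ = 1 := by
    rw [mul_comm, Complex.mul_conj, Complex.normSq_eq_norm_sq, hμ]; simp
  set k : ℝ := (μ * a + (starRingEnd ℂ) μ * d).re with hk
  have hkc : μ * a + (starRingEnd ℂ) μ * d = (k : ℂ) := by
    apply Complex.ext
    · simp [hk]
    · simp only [Complex.add_im, Complex.mul_im, Complex.ofReal_im, Complex.sub_re,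
        Complex.sub_im, Complex.conj_re, Complex.conj_im] at him ⊢
      linarith
  set e : ℝ := (μ * inner ℂ x y).re with he
  have hxx : inner ℂ x x = (1 : ℂ) := by rw [inner_self_eq_norm_sq_to_K, hx]; simp
  have hyy : inner ℂ y y = (1 : ℂ) := by rw [inner_self_eq_norm_sq_to_K, hy]; simp
  have hyx : inner ℂ y x = (starRingEnd ℂ) (inner ℂ x y) := (inner_conj_symm y x).symm
  have hec : μ * inner ℂ x y + (starRingEnd ℂ) μ * inner ℂ y x = ((2 * e : ℝ) : ℂ) := by
    rw [hyx, ← map_mul, Complex.add_conj]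
  have hax : inner ℂ x (T y) = a * D + w₁ * inner ℂ x y := by rw [ha]; field_simp; ring
  have hdx : inner ℂ y (T x) = d * D + w₁ * inner ℂ y x := by rw [hd]; field_simp; ring
  let z : ℝ → EuclideanSpace ℂ n := fun t => ((1 - t : ℝ) : ℂ) • x + ((t : ℂ) * μ) • y
  have hzn : ∀ t, (‖z t‖ : ℂ) ^ 2 = (((1 - t) ^ 2 + t ^ 2 + t * (1 - t) * (2 * e) : ℝ) : ℂ) := by
    intro t
    have : inner ℂ (z t) (z t) = (‖z t‖ : ℂ) ^ 2 := by rw [inner_self_eq_norm_sq_to_K]; rfl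
    rw [← this]
    simp only [z, inner_add_left, inner_add_right, inner_smul_left, inner_smul_right, hxx, hyy,
      map_mul, Complex.conj_ofReal]
    push_cast at hec ⊢
    linear_combination (t : ℂ) * (1 - t) * hec + (t : ℂ) ^ 2 * hμ2
  have hzT : ∀ t, inner ℂ (z t) (T (z t)) =
      w₁ * (‖z t‖ : ℂ) ^ 2 + D * ((t ^ 2 + t * (1 - t) * k : ℝ) : ℂ) := by
    intro t
    rw [hzn]
    simp only [z, map_add, map_smul, inner_add_left, inner_add_right, inner_smul_left,
      inner_smul_right, map_mul, Complex.conj_ofReal, ← hw₁, ← hw₂, hax, hdx]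
    push_cast at hec hkc ⊢
    linear_combination (t : ℂ) * (1 - t) * w₁ * hec + (t : ℂ) * (1 - t) * D * hkc
      + (t : ℂ) ^ 2 * w₂ * hμ2 - (t : ℂ) ^ 2 * hDdef
  obtain ⟨t, -, ht⟩ : (0 : ℝ) ∈ (fun t : ℝ => t ^ 2 + t * (1 - t) * k -
      s * ((1 - t) ^ 2 + t ^ 2 + t * (1 - t) * (2 * e))) '' Set.Icc 0 1 := by
    apply intermediate_value_Icc zero_le_one
    · fun_prop
    · constructor <;> norm_num <;> linarith
  have hval : inner ℂ (z t) (T (z t)) = (w₁ + s • D) * (‖z t‖ : ℂ) ^ 2 := by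
    rw [hzT, add_mul, hzn]
    have : t ^ 2 + t * (1 - t) * k = s * ((1 - t) ^ 2 + t ^ 2 + t * (1 - t) * (2 * e)) := by
      simpa [sub_eq_zero] using ht
    rw [this, Complex.real_smul]
    push_cast
    ring
  -- If `z t = 0`, then `t = 1/2` and `x = -μ y`, so `x` and `y` give the same value, against `hD`.
  refine mem_numericalRange_of_inner_eq (z := z t) (fun hz0 => hD ?_) hval
  have h1 : ((1 - t : ℝ) : ℂ) • x = -(((t : ℂ) * μ) • y) := eq_neg_of_add_eq_zero_left hz0
  have h2 : |1 - t| = |t| := by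
    have := congrArg norm h1
    rwa [norm_neg, norm_smul, norm_smul, norm_mul, hx, hy, hμ, Complex.norm_real,
      Complex.norm_real, mul_one, mul_one, mul_one] at this
  have h3 : t = 1 / 2 := by
    rcases abs_eq_abs.mp h2 with h | h <;> linarith
  have h4 : x = -(μ • y) := by
    have h5 : ((1 - t : ℝ) : ℂ) = (t : ℂ) := by rw [h3]; norm_num
    have h6 : (t : ℂ) ≠ 0 := by rw [h3]; norm_num
    rw [h5, mul_smul, ← smul_neg] at h1
    exact smul_right_injective _ h6 h1
  have h5 : w₁ = w₂ := by
    rw [hw₁, hw₂, h4]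
    simp only [map_neg, map_smul, inner_neg_left, inner_neg_right, inner_smul_left,
      inner_smul_right]
    linear_combination (inner ℂ y (T y)) * hμ2
  rw [hDdef, h5, sub_self]

theorem isCompact_numericalRange {n : Type*} [Fintype n] [DecidableEq n] (A : Matrix n n ℂ) :
    IsCompact (numericalRange A) := by
  have h : numericalRange A = (fun x : EuclideanSpace ℂ n =>
      inner ℂ x (Matrix.toEuclideanLin A x)) '' Metric.sphere 0 1 := by
    ext w
    simp [numericalRange, eq_comm]
  rw [h]
  refine (isCompact_sphere _ _).image ?_
  exact continuous_id.inner (LinearMap.continuous_of_finiteDimensional _)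

/-! ### Support functions -/

/-- `m` is the value at `(x, y)` of the support function of the planar set `S`, and is attained. -/
def HasSupport (S : Set ℂ) (x y m : ℝ) : Prop :=
  IsGreatest ((fun w : ℂ => x * w.re + y * w.im) '' S) m

theorem HasSupport.unique {S : Set ℂ} {x y m m' : ℝ} (h : HasSupport S x y m)
    (h' : HasSupport S x y m') : m = m' :=
  IsGreatest.unique h h'

theorem HasSupport.le {S : Set ℂ} {x y m : ℝ} (h : HasSupport S x y m) {w : ℂ} (hw : w ∈ S) :
    x * w.re + y * w.im ≤ m :=
  h.2 ⟨w, hw, rfl⟩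

theorem HasSupport.convexHull {S : Set ℂ} {x y m : ℝ} (h : HasSupport S x y m) :
    HasSupport (convexHull ℝ S) x y m := by
  refine ⟨Set.image_mono (subset_convexHull ℝ S) h.1, ?_⟩
  rintro _ ⟨w, hw, rfl⟩
  have hc : Convex ℝ {w : ℂ | x * w.re + y * w.im ≤ m} :=
    convex_halfSpace_le (IsLinearMap.mk (fun a b => by simp; ring) (fun a b => by simp; ring)) m
  exact convexHull_min (fun w hw => h.le hw) hc hw

theorem HasSupport.union {S S' : Set ℂ} {x y m m' : ℝ} (h : HasSupport S x y m)
    (h' : HasSupport S' x y m') : HasSupport (S ∪ S') x y (max m m') := by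
  unfold HasSupport
  rw [Set.image_union]
  exact IsGreatest.union h h'

theorem exists_separating_direction {K : Set ℂ} (hc : Convex ℝ K) (hK : IsClosed K) {p : ℂ}
    (hp : p ∉ K) : ∃ x y : ℝ, ∀ w ∈ K, x * w.re + y * w.im < x * p.re + y * p.im := by
  obtain ⟨f, u, h1, h2⟩ := geometric_hahn_banach_closed_point (E := ℂ) hc hK hp
  have hf : ∀ w : ℂ, f w = f 1 * w.re + f Complex.I * w.im := by
    intro w
    conv_lhs => rw [← Complex.re_add_im w]
    have : (w.re : ℂ) + w.im * Complex.I = w.re • (1 : ℂ) + w.im • Complex.I := by simp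
    rw [this, map_add, map_smul, map_smul]
    simp [mul_comm]
  refine ⟨f 1, f Complex.I, fun w hw => ?_⟩
  rw [← hf, ← hf]
  exact (h1 w hw).trans h2

theorem subset_of_hasSupport_le {S K : Set ℂ} (hc : Convex ℝ K) (hK : IsClosed K)
    (h : ∀ x y, ∃ m m', HasSupport S x y m ∧ HasSupport K x y m' ∧ m ≤ m') : S ⊆ K := by
  intro p hp
  by_contra hpK
  obtain ⟨x, y, hxy⟩ := exists_separating_direction hc hK hpK
  obtain ⟨m, m', hm, hm', hle⟩ := h x y
  obtain ⟨w, hw, hwm⟩ := hm'.1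
  have := hm.le hp
  have := hxy w hw
  simp only at hwm
  linarith

/-! ### Ellipses and positive definite forms -/

theorem isGreatest_cos_sin (P Q : ℝ) :
    IsGreatest (Set.range fun t : ℝ => P * Real.cos t + Q * Real.sin t) √(P ^ 2 + Q ^ 2) := by
  constructor
  · set z : ℂ := ⟨P, Q⟩ with hz
    have hn : √(P ^ 2 + Q ^ 2) = ‖z‖ := by
      rw [Complex.norm_def, Complex.normSq_apply]
      congr 1
      simp only [hz]
      ring
    have hsq : P ^ 2 + Q ^ 2 = ‖z‖ ^ 2 := by rw [← hn, Real.sq_sqrt (by positivity)]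
    have hP : ‖z‖ * Real.cos z.arg = P := Complex.norm_mul_cos_arg z
    have hQ : ‖z‖ * Real.sin z.arg = Q := Complex.norm_mul_sin_arg z
    refine ⟨z.arg, ?_⟩
    rw [hn]
    have h1 := Real.cos_sq_add_sin_sq z.arg
    simp only
    rw [← hP, ← hQ]
    linear_combination ‖z‖ * h1
  · rintro _ ⟨t, rfl⟩
    apply Real.le_sqrt_of_sq_le
    nlinarith [sq_nonneg (P * Real.sin t - Q * Real.cos t), Real.cos_sq_add_sin_sq t]

theorem hasSupport_ellipse (c : ℂ) (r s φ x y : ℝ) :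
    HasSupport (Set.range fun t : ℝ => c + Complex.exp (φ * Complex.I) *
        ((r * Real.cos t : ℝ) + (s * Real.sin t : ℝ) * Complex.I)) x y
      (x * c.re + y * c.im + √((r ^ 2 * Real.cos φ ^ 2 + s ^ 2 * Real.sin φ ^ 2) * x ^ 2
        + 2 * ((r ^ 2 - s ^ 2) * Real.cos φ * Real.sin φ) * x * y
        + (r ^ 2 * Real.sin φ ^ 2 + s ^ 2 * Real.cos φ ^ 2) * y ^ 2)) := by
  have key := isGreatest_cos_sin (r * (x * Real.cos φ + y * Real.sin φ))
    (s * (-x * Real.sin φ + y * Real.cos φ))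
  have hq : (r * (x * Real.cos φ + y * Real.sin φ)) ^ 2
      + (s * (-x * Real.sin φ + y * Real.cos φ)) ^ 2 =
      (r ^ 2 * Real.cos φ ^ 2 + s ^ 2 * Real.sin φ ^ 2) * x ^ 2
        + 2 * ((r ^ 2 - s ^ 2) * Real.cos φ * Real.sin φ) * x * y
        + (r ^ 2 * Real.sin φ ^ 2 + s ^ 2 * Real.cos φ ^ 2) * y ^ 2 := by ring
  rw [hq] at key
  have hval : ∀ t : ℝ, x * (c + Complex.exp (φ * Complex.I) *
        ((r * Real.cos t : ℝ) + (s * Real.sin t : ℝ) * Complex.I)).re +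
      y * (c + Complex.exp (φ * Complex.I) *
        ((r * Real.cos t : ℝ) + (s * Real.sin t : ℝ) * Complex.I)).im =
      x * c.re + y * c.im + (r * (x * Real.cos φ + y * Real.sin φ) * Real.cos t
        + s * (-x * Real.sin φ + y * Real.cos φ) * Real.sin t) := by
    intro t
    simp only [Complex.add_re, Complex.mul_re, Complex.exp_ofReal_mul_I_re,
      Complex.exp_ofReal_mul_I_im, Complex.ofReal_re, Complex.ofReal_im, Complex.I_re,
      Complex.I_im, Complex.add_im, Complex.mul_im]
    ring
  constructor
  · obtain ⟨t, ht⟩ := key.1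
    exact ⟨_, ⟨t, rfl⟩, by simp only at ht ⊢; rw [hval, ht]⟩
  · rintro _ ⟨_, ⟨t, rfl⟩, rfl⟩
    simp only
    rw [hval]
    have := key.2 ⟨t, rfl⟩
    linarith

theorem IsEllipseWithCenter.isCompact {E : Set ℂ} {c : ℂ} (h : IsEllipseWithCenter E c) :
    IsCompact E := by
  obtain ⟨r, s, φ, -, -, rfl⟩ := h
  have hp : Function.Periodic (fun t : ℝ => c + Complex.exp (φ * Complex.I) *
      ((r * Real.cos t : ℝ) + (s * Real.sin t : ℝ) * Complex.I)) (2 * Real.pi) := by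
    intro t
    simp only [Real.cos_add_two_pi, Real.sin_add_two_pi]
  rw [← hp.image_Icc Real.two_pi_pos 0]
  refine isCompact_Icc.image ?_
  fun_prop

theorem IsEllipseWithCenter.exists_hasSupport {E : Set ℂ} {c : ℂ} (h : IsEllipseWithCenter E c) :
    ∃ α β γ : ℝ, 0 < γ ∧ β ^ 2 < α * γ ∧ ∀ x y : ℝ,
      HasSupport E x y (x * c.re + y * c.im + √(α * x ^ 2 + 2 * β * x * y + γ * y ^ 2)) := by
  obtain ⟨r, s, φ, hr, hs, rfl⟩ := h
  have h1 := Real.cos_sq_add_sin_sq φ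
  refine ⟨_, _, _, ?_, ?_, fun x y => hasSupport_ellipse c r s φ x y⟩
  · have : 0 < min (r ^ 2) (s ^ 2) := by positivity
    nlinarith [mul_le_mul_of_nonneg_right (min_le_left (r ^ 2) (s ^ 2)) (sq_nonneg (Real.sin φ)),
      mul_le_mul_of_nonneg_right (min_le_right (r ^ 2) (s ^ 2)) (sq_nonneg (Real.cos φ))]
  · have : (r ^ 2 * Real.cos φ ^ 2 + s ^ 2 * Real.sin φ ^ 2) *
        (r ^ 2 * Real.sin φ ^ 2 + s ^ 2 * Real.cos φ ^ 2) -
        ((r ^ 2 - s ^ 2) * Real.cos φ * Real.sin φ) ^ 2 = (r * s) ^ 2 := by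
      linear_combination (r * s) ^ 2 * (Real.cos φ ^ 2 + Real.sin φ ^ 2 + 1) * h1
    have : 0 < (r * s) ^ 2 := by positivity
    linarith

/-- Every positive definite quadratic form comes from an ellipse with any prescribed center. -/
theorem exists_ellipse_hasSupport (c : ℂ) {α β γ : ℝ} (hγ : 0 < γ) (hdet : β ^ 2 < α * γ) :
    ∃ E, IsEllipseWithCenter E c ∧ ∀ x y : ℝ,
      HasSupport E x y (x * c.re + y * c.im + √(α * x ^ 2 + 2 * β * x * y + γ * y ^ 2)) := by
  have hα : 0 < α := by
    by_contra h
    nlinarith [sq_nonneg β, mul_nonneg (not_lt.mp h |> neg_nonneg.mpr) hγ.le]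
  -- Diagonalization: `z` has modulus `r² - s²` and argument twice the angle of the major axis; the
  -- eigenvalues `(α + γ ± ‖z‖) / 2` are the squared semi-axes.
  set z : ℂ := ⟨α - γ, 2 * β⟩ with hz
  set φ := z.arg / 2 with hφ
  have harg : z.arg = 2 * φ := by rw [hφ]; ring
  have hn2 : ‖z‖ ^ 2 = (α - γ) ^ 2 + (2 * β) ^ 2 := by
    rw [← Complex.normSq_eq_norm_sq, Complex.normSq_apply]; simp only [hz]; ring
  have hlt : ‖z‖ < α + γ := by
    apply lt_of_pow_lt_pow_left₀ 2 (by positivity)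
    rw [hn2]; nlinarith
  have hc : ‖z‖ * Real.cos z.arg = α - γ := Complex.norm_mul_cos_arg z
  have hs : ‖z‖ * Real.sin z.arg = 2 * β := Complex.norm_mul_sin_arg z
  have h0 := norm_nonneg z
  rw [harg] at hc hs
  rw [Real.cos_two_mul] at hc
  rw [Real.sin_two_mul] at hs
  have h1 := Real.cos_sq_add_sin_sq φ
  have hr : √((α + γ + ‖z‖) / 2) ^ 2 = (α + γ + ‖z‖) / 2 := Real.sq_sqrt (by positivity)
  have hs' : √((α + γ - ‖z‖) / 2) ^ 2 = (α + γ - ‖z‖) / 2 := Real.sq_sqrt (by linarith)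
  refine ⟨_, ⟨√((α + γ + ‖z‖) / 2), √((α + γ - ‖z‖) / 2), φ, Real.sqrt_pos.mpr (by positivity),
    Real.sqrt_pos.mpr (by linarith), rfl⟩, fun x y => ?_⟩
  convert hasSupport_ellipse c (√((α + γ + ‖z‖) / 2)) (√((α + γ - ‖z‖) / 2)) φ x y using 3
  rw [hr, hs']
  linear_combination x ^ 2 * ((-1 / 2 : ℝ) * hc - ((α + γ - ‖z‖) / 2) * h1) - x * y * hs
    + y ^ 2 * ((1 / 2 : ℝ) * hc - ((α + γ + ‖z‖) / 2) * h1)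

/-! ### Support function of the numerical range -/

/-- The squared modulus of `x b + i y`. -/
def colForm (b : ℂ) (x y : ℝ) : ℝ := (x * b.re) ^ 2 + (x * b.im + y) ^ 2

theorem inner_triangularizedMatrix (b₁ b₂ : ℂ) (b : ℝ) (z : EuclideanSpace ℂ (Fin 4)) :
    inner ℂ z (Matrix.toEuclideanLin (triangularizedMatrix 0 b₁ b₂ b) z) =
      (starRingEnd ℂ) (z 0) * (((starRingEnd ℂ) b₁ + 1) * z 2)
      + (starRingEnd ℂ) (z 1) * (b * z 2 + ((starRingEnd ℂ) b₂ + 1) * z 3)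
      + (starRingEnd ℂ) (z 2) * ((b₁ - 1) * z 0 + b * z 1)
      + (starRingEnd ℂ) (z 3) * ((b₂ - 1) * z 1) := by
  rw [PiLp.inner_apply, Fin.sum_univ_four]
  simp [triangularizedMatrix, Matrix.toLpLin_apply, dotProduct, Fin.sum_univ_four]
  ring

/-- The form `z ↦ Re (conj (x + i y) ⟨A z, z⟩)` in terms of the entries of `x B + i y`. -/
theorem re_add_im_inner_triangularizedMatrix (b₁ b₂ : ℂ) (b x y : ℝ)
    (z : EuclideanSpace ℂ (Fin 4)) :
    let w := inner ℂ z (Matrix.toEuclideanLin (triangularizedMatrix 0 b₁ b₂ b) z)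
    x * w.re + y * w.im =
      2 * ((starRingEnd ℂ) (z 2) * ((x * b₁ + y * Complex.I) * z 0 + x * b * z 1)
        + (starRingEnd ℂ) (z 3) * ((x * b₂ + y * Complex.I) * z 1)).re := by
  simp only [inner_triangularizedMatrix, Complex.add_re, Complex.add_im, Complex.mul_re,
    Complex.mul_im, Complex.sub_re, Complex.sub_im, Complex.conj_re, Complex.conj_im,
    Complex.ofReal_re, Complex.ofReal_im, Complex.one_re, Complex.one_im, Complex.I_re,
    Complex.I_im]
  ring

theorem colForm_eq_norm (b : ℂ) (x y : ℝ) : colForm b x y = ‖(x * b + y * Complex.I : ℂ)‖ ^ 2 := by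
  rw [← Complex.normSq_eq_norm_sq, Complex.normSq_apply]
  simp [colForm]
  ring

/-- The bigger eigenvalue of a Hermitian `2 × 2` matrix bounds its quadratic form. -/
theorem sq_add_sq_le_of_charpoly {p β q M a d : ℝ}
    (hM : M ^ 2 - (p ^ 2 + q ^ 2 + β ^ 2) * M + p ^ 2 * q ^ 2 = 0)
    (hM2 : p ^ 2 + q ^ 2 + β ^ 2 ≤ 2 * M) :
    (p * a + β * d) ^ 2 + (q * d) ^ 2 ≤ M * (a ^ 2 + d ^ 2) := by
  -- The factors are the diagonal entries of `M - C* C` for `C = [p, β; 0, q]`. Zero determinant and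
  -- nonnegative trace make this matrix positive semidefinite.
  have hAB : (M - p ^ 2) * (M - q ^ 2 - β ^ 2) = (p * β) ^ 2 := by linear_combination hM
  have hA : 0 ≤ M - p ^ 2 := by
    by_contra h
    nlinarith [sq_nonneg (p * β)]
  have hB : 0 ≤ M - q ^ 2 - β ^ 2 := by
    by_contra h
    nlinarith [sq_nonneg (p * β)]
  suffices h : 0 ≤ (M - p ^ 2) * a ^ 2 + (M - q ^ 2 - β ^ 2) * d ^ 2 - 2 * (p * β) * (a * d) by
    linarith
  rcases hA.eq_or_lt with h | h
  · have : p * β = 0 := by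
      rw [← h, zero_mul] at hAB
      exact pow_eq_zero_iff two_ne_zero |>.mp hAB.symm
    rw [← h, this]
    have := mul_nonneg hB (sq_nonneg d)
    linarith
  · have h2 : (M - p ^ 2) * ((M - p ^ 2) * a ^ 2 + (M - q ^ 2 - β ^ 2) * d ^ 2
        - 2 * (p * β) * (a * d)) = ((M - p ^ 2) * a - p * β * d) ^ 2 := by
      linear_combination d ^ 2 * hAB
    exact nonneg_of_mul_nonneg_right (h2 ▸ sq_nonneg _) h

theorem two_mul_re_conj_mul_le (u v : ℂ) {m : ℝ} (hm : 0 < m) :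
    2 * ((starRingEnd ℂ) v * u).re ≤ m * ‖v‖ ^ 2 + ‖u‖ ^ 2 / m := by
  have h1 : ((starRingEnd ℂ) v * u).re ≤ ‖v‖ * ‖u‖ := by
    calc _ ≤ ‖(starRingEnd ℂ) v * u‖ := Complex.re_le_norm _
      _ = _ := by simp
  have h2 : m * ‖v‖ ^ 2 + ‖u‖ ^ 2 / m - 2 * (‖v‖ * ‖u‖) = (m * ‖v‖ - ‖u‖) ^ 2 / m := by
    field_simp
    ring
  have : 0 ≤ (m * ‖v‖ - ‖u‖) ^ 2 / m := by positivity
  linarith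

/-- Weighted AM-GM with weight `m`, followed by `‖C z‖² ≤ m² ‖z‖²`, gives each half of the vector
the same factor `m`. The division by `m` makes `m = 0` a separate case. -/
theorem two_mul_re_block_le (c₁ c₂ z₀ z₁ z₂ z₃ : ℂ) (β m : ℝ) (hm : 0 ≤ m)
    (hP : m ^ 4 - (‖c₁‖ ^ 2 + ‖c₂‖ ^ 2 + β ^ 2) * m ^ 2 + ‖c₁‖ ^ 2 * ‖c₂‖ ^ 2 = 0)
    (hT : ‖c₁‖ ^ 2 + ‖c₂‖ ^ 2 + β ^ 2 ≤ 2 * m ^ 2) :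
    2 * ((starRingEnd ℂ) z₂ * (c₁ * z₀ + β * z₁) + (starRingEnd ℂ) z₃ * (c₂ * z₁)).re ≤
      m * (‖z₀‖ ^ 2 + ‖z₁‖ ^ 2 + ‖z₂‖ ^ 2 + ‖z₃‖ ^ 2) := by
  rcases hm.eq_or_lt with h | h
  · subst h
    have h1 : ‖c₁‖ ^ 2 = 0 := by nlinarith [sq_nonneg ‖c₁‖, sq_nonneg ‖c₂‖, sq_nonneg β]
    have h2 : ‖c₂‖ ^ 2 = 0 := by nlinarith [sq_nonneg ‖c₁‖, sq_nonneg ‖c₂‖, sq_nonneg β]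
    have h3 : β ^ 2 = 0 := by nlinarith [sq_nonneg ‖c₁‖, sq_nonneg ‖c₂‖, sq_nonneg β]
    simp only [ne_eq, OfNat.ofNat_ne_zero, not_false_eq_true, pow_eq_zero_iff, norm_eq_zero]
      at h1 h2 h3
    simp [h1, h2, h3]
  · have h1 := two_mul_re_conj_mul_le (c₁ * z₀ + β * z₁) z₂ h
    have h2 := two_mul_re_conj_mul_le (c₂ * z₁) z₃ h
    have h3 : ‖c₁ * z₀ + β * z₁‖ ≤ ‖c₁‖ * ‖z₀‖ + |β| * ‖z₁‖ := by
      refine (norm_add_le _ _).trans_eq ?_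
      simp
    have h4 := sq_add_sq_le_of_charpoly (q := ‖c₂‖) (M := m ^ 2) (p := ‖c₁‖) (β := |β|)
      (a := ‖z₀‖) (d := ‖z₁‖) (by rw [sq_abs]; linear_combination hP)
      (by rwa [sq_abs])
    have h5 : ‖c₁ * z₀ + β * z₁‖ ^ 2 + ‖c₂ * z₁‖ ^ 2 ≤ m ^ 2 * (‖z₀‖ ^ 2 + ‖z₁‖ ^ 2) := by
      rw [norm_mul c₂]
      exact (add_le_add_left (pow_le_pow_left₀ (norm_nonneg _) h3 2) _).trans h4
    have h6 : ‖c₁ * z₀ + β * z₁‖ ^ 2 / m + ‖c₂ * z₁‖ ^ 2 / m ≤ m * (‖z₀‖ ^ 2 + ‖z₁‖ ^ 2) := by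
      rw [← add_div, div_le_iff₀ h]
      linarith
    rw [Complex.add_re]
    linarith

/-- The polynomial is the determinant of `[0, C*; C, 0] - m`, so a root gives a kernel vector, at
which the support value is attained. -/
theorem exists_block_eigenvector (c₁ c₂ : ℂ) (β m : ℝ)
    (hP : m ^ 4 - (‖c₁‖ ^ 2 + ‖c₂‖ ^ 2 + β ^ 2) * m ^ 2 + ‖c₁‖ ^ 2 * ‖c₂‖ ^ 2 = 0) :
    ∃ z : EuclideanSpace ℂ (Fin 4), z ≠ 0 ∧ (starRingEnd ℂ) c₁ * z 2 = m * z 0 ∧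
      β * z 2 + (starRingEnd ℂ) c₂ * z 3 = m * z 1 ∧ c₁ * z 0 + β * z 1 = m * z 2 ∧
      c₂ * z 1 = m * z 3 := by
  have hdet : (!![-(m : ℂ), 0, (starRingEnd ℂ) c₁, 0; 0, -m, β, (starRingEnd ℂ) c₂;
      c₁, β, -m, 0; 0, c₂, 0, -m] : Matrix (Fin 4) (Fin 4) ℂ).det = 0 := by
    have h1 := Complex.mul_conj' c₁
    have h2 := Complex.mul_conj' c₂
    have hP' := congrArg (fun r : ℝ => (r : ℂ)) hP
    simp only [Complex.ofReal_add, Complex.ofReal_sub, Complex.ofReal_mul, Complex.ofReal_pow,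
      Complex.ofReal_zero, ← h1, ← h2] at hP'
    simp [Matrix.det_succ_row_zero, Fin.sum_univ_succ, Fin.succAbove]
    linear_combination hP'
  obtain ⟨v, hv, hMv⟩ := Matrix.exists_mulVec_eq_zero_iff.mpr hdet
  refine ⟨WithLp.toLp 2 v, by simpa using hv, ?_, ?_, ?_, ?_⟩
  · have := congrFun hMv 0
    simp [Matrix.mulVec, dotProduct, Fin.sum_univ_four] at this
    simp only
    linear_combination this
  · have := congrFun hMv 1
    simp [Matrix.mulVec, dotProduct, Fin.sum_univ_four] at this
    simp only
    linear_combination this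
  · have := congrFun hMv 2
    simp [Matrix.mulVec, dotProduct, Fin.sum_univ_four] at this
    simp only
    linear_combination this
  · have := congrFun hMv 3
    simp [Matrix.mulVec, dotProduct, Fin.sum_univ_four] at this
    simp only
    linear_combination this

/-- The support function of the numerical range is the biggest eigenvalue of the Hermitian
part of the rotated matrix. -/
theorem hasSupport_numericalRange {b₁ b₂ : ℂ} {b x y m : ℝ} (hm : 0 ≤ m)
    (hP : m ^ 4 - (colForm b₁ x y + colForm b₂ x y + (x * b) ^ 2) * m ^ 2
      + colForm b₁ x y * colForm b₂ x y = 0)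
    (hT : colForm b₁ x y + colForm b₂ x y + (x * b) ^ 2 ≤ 2 * m ^ 2) :
    HasSupport (numericalRange (triangularizedMatrix 0 b₁ b₂ b)) x y m := by
  rw [colForm_eq_norm, colForm_eq_norm] at hP hT
  have hsum : ∀ z : EuclideanSpace ℂ (Fin 4),
      ‖z‖ ^ 2 = ‖z 0‖ ^ 2 + ‖z 1‖ ^ 2 + ‖z 2‖ ^ 2 + ‖z 3‖ ^ 2 := by
    intro z
    rw [EuclideanSpace.norm_sq_eq, Fin.sum_univ_four]
  constructor
  · obtain ⟨z, hz, e0, e1, e2, e3⟩ := exists_block_eigenvector _ _ _ _ hP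
    have hn : ‖z‖ ^ 2 ≠ 0 := by simpa using hz
    have hval := re_add_im_inner_triangularizedMatrix b₁ b₂ b x y z
    set w := inner ℂ z (Matrix.toEuclideanLin (triangularizedMatrix 0 b₁ b₂ b) z) with hw
    refine ⟨w / ((‖z‖ ^ 2 : ℝ) : ℂ), mem_numericalRange_of_inner_eq hz ?_, ?_⟩
    · rw [← hw]
      have : ((‖z‖ ^ 2 : ℝ) : ℂ) ≠ 0 := by exact_mod_cast hn
      rw [← Complex.ofReal_pow, div_mul_cancel₀ _ this]
    · simp only [Complex.div_ofReal_re, Complex.div_ofReal_im]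
      rw [← mul_div_assoc, ← mul_div_assoc, ← add_div, div_eq_iff hn, hval, hsum]
      push_cast at e0 e1 e2 e3
      have h2 := Complex.conj_mul' (z 2)
      have h3 := Complex.conj_mul' (z 3)
      have h0 := Complex.conj_mul' (z 0)
      have h1 := Complex.conj_mul' (z 1)
      have e0' := congrArg (starRingEnd ℂ) e0
      have e1' := congrArg (starRingEnd ℂ) e1
      simp only [map_mul, map_add, map_neg, neg_neg, Complex.conj_conj, Complex.conj_ofReal, Complex.conj_I]
        at e0' e1'
      rw [← Complex.ofReal_inj]
      -- The lower and the conjugated upper eigenvector equations evaluate the same sum, so both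
      -- halves of `z` contribute equally and the form equals `m ‖z‖²`.
      have hA : (starRingEnd ℂ) (z 2) * ((x * b₁ + y * Complex.I) * z 0 + x * b * z 1)
        + (starRingEnd ℂ) (z 3) * ((x * b₂ + y * Complex.I) * z 1) =
          ((m * (‖z 2‖ ^ 2 + ‖z 3‖ ^ 2) : ℝ) : ℂ) := by
        push_cast
        linear_combination (starRingEnd ℂ) (z 2) * e2 + (starRingEnd ℂ) (z 3) * e3 + m * h2 + m * h3
      have hB : (starRingEnd ℂ) (z 2) * ((x * b₁ + y * Complex.I) * z 0 + x * b * z 1)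
        + (starRingEnd ℂ) (z 3) * ((x * b₂ + y * Complex.I) * z 1) =
          ((m * (‖z 0‖ ^ 2 + ‖z 1‖ ^ 2) : ℝ) : ℂ) := by
        push_cast at e0' e1' ⊢
        linear_combination z 0 * e0' + z 1 * e1' + m * h0 + m * h1
      have hAB : m * (‖z 2‖ ^ 2 + ‖z 3‖ ^ 2) = m * (‖z 0‖ ^ 2 + ‖z 1‖ ^ 2) := by
        exact_mod_cast hA.symm.trans hB
      rw [hA, Complex.ofReal_inj, Complex.ofReal_re]
      linear_combination hAB
  · rintro _ ⟨w, ⟨z, hz, rfl⟩, rfl⟩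
    have hval := re_add_im_inner_triangularizedMatrix b₁ b₂ b x y z
    simp only at hval ⊢
    rw [hval]
    have := two_mul_re_block_le _ _ (z 0) (z 1) (z 2) (z 3) _ m hm hP hT
    rw [← hsum, hz] at this
    push_cast at this
    simpa using this

/-- The support function of the numerical range is a root of the Kippenhahn polynomial. -/
theorem exists_hasSupport_numericalRange (b₁ b₂ : ℂ) (b x y : ℝ) :
    ∃ m, HasSupport (numericalRange (triangularizedMatrix 0 b₁ b₂ b)) x y m ∧
      m ^ 4 - (colForm b₁ x y + colForm b₂ x y + (x * b) ^ 2) * m ^ 2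
      + colForm b₁ x y * colForm b₂ x y = 0 := by
  have h1 : 0 ≤ colForm b₁ x y := by unfold colForm; positivity
  have h2 : 0 ≤ colForm b₂ x y := by unfold colForm; positivity
  set f₁ := colForm b₁ x y with hf₁
  set f₂ := colForm b₂ x y with hf₂
  set T := f₁ + f₂ + (x * b) ^ 2 with hT
  have hD : 0 ≤ T ^ 2 - 4 * (f₁ * f₂) := by
    have : T ^ 2 - 4 * (f₁ * f₂) = (f₁ - f₂) ^ 2 + 2 * (x * b) ^ 2 * (f₁ + f₂)
      + ((x * b) ^ 2) ^ 2 := by rw [hT]; ring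
    rw [this]; positivity
  have hs := Real.sq_sqrt hD
  have hm := Real.sq_sqrt (show 0 ≤ (T + √(T ^ 2 - 4 * (f₁ * f₂))) / 2 by positivity)
  set m := √((T + √(T ^ 2 - 4 * (f₁ * f₂))) / 2)
  have hP : m ^ 4 - T * m ^ 2 + f₁ * f₂ = 0 := by
    have : m ^ 4 = (m ^ 2) ^ 2 := by ring
    rw [this, hm]
    linear_combination hs / 4
  refine ⟨m, hasSupport_numericalRange (Real.sqrt_nonneg _) hP ?_, hP⟩
  rw [hm]
  have := Real.sqrt_nonneg (T ^ 2 - 4 * (f₁ * f₂))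
  linarith

/-! ### Splitting of the Kippenhahn polynomial -/

open Polynomial in
/-- The square root of a positive real quadratic polynomial is not a rational function. -/
theorem eq_zero_of_infinite_add_mul_sqrt_eq_zero {a b q : ℝ[X]} (hq : q.natDegree = 2)
    (hpos : ∀ t, 0 < q.eval t) {S : Set ℝ} (hS : S.Infinite)
    (h : ∀ t ∈ S, a.eval t + b.eval t * √(q.eval t) = 0) : a = 0 ∧ b = 0 := by
  have hsq : a ^ 2 = b ^ 2 * q := by
    refine eq_of_infinite_eval_eq _ _ (hS.mono fun t ht => ?_)
    have h1 := h t ht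
    have h2 := Real.sq_sqrt (hpos t).le
    simp only [Set.mem_ofPred_eq, eval_pow, eval_mul]
    linear_combination (a.eval t - b.eval t * √(q.eval t)) * h1 + (b.eval t) ^ 2 * h2
  by_cases hb : b = 0
  · refine ⟨?_, hb⟩
    rw [hb] at hsq
    simpa using hsq
  exfalso
  have hq0 : q ≠ 0 := by rintro rfl; simp at hq
  have ha : a ≠ 0 := by
    rintro rfl
    have : b ^ 2 * q ≠ 0 := mul_ne_zero (pow_ne_zero 2 hb) hq0
    apply this
    rw [← hsq]; simp
  have hirr : Irreducible q := by
    rw [irreducible_iff_roots_eq_zero_of_degree_le_three (by omega) (by omega)]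
    rw [Multiset.eq_zero_iff_forall_notMem]
    intro t ht
    exact (hpos t).ne' (isRoot_of_mem_roots ht)
  have hp : Prime q := hirr.prime
  have hfin : ∀ {p : ℝ[X]}, p ≠ 0 → FiniteMultiplicity q p := fun hp0 =>
    FiniteMultiplicity.of_prime_left hp hp0
  -- Parity: the prime `q` divides `a²` to an even power and `b² q` to an odd one.
  have hm := congrArg (multiplicity q) hsq
  rw [multiplicity_mul hp (hfin (mul_ne_zero (pow_ne_zero 2 hb) hq0)),
    (hfin ha).multiplicity_pow hp, (hfin hb).multiplicity_pow hp, multiplicity_self] at hm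
  omega

open Polynomial in
/-- If infinitely many points of a conic branch lie on the Kippenhahn curve, so does the conic. -/
theorem eq_of_infinite_kippenhahn {l q T F : ℝ[X]} (hl : l ≠ 0) (hq : q.natDegree = 2)
    (hpos : ∀ t, 0 < q.eval t) {S : Set ℝ} (hS : S.Infinite)
    (h : ∀ t ∈ S, (l.eval t + √(q.eval t)) ^ 4 - T.eval t * (l.eval t + √(q.eval t)) ^ 2
      + F.eval t = 0) : T = 2 * (l ^ 2 + q) ∧ F = (l ^ 2 - q) ^ 2 := by
  -- `a` and `b` are the rational part and the coefficient of `√q` in the quartic at `l + √q`.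
  obtain ⟨ha, hb⟩ := eq_zero_of_infinite_add_mul_sqrt_eq_zero
    (a := (l ^ 2 + q) ^ 2 + 4 * l ^ 2 * q - T * (l ^ 2 + q) + F)
    (b := 2 * l * (2 * (l ^ 2 + q) - T)) hq hpos hS (fun t ht => by
      have h1 := h t ht
      have h2 := Real.sq_sqrt (hpos t).le
      simp only [eval_add, eval_sub, eval_mul, eval_pow, eval_ofNat]
      generalize √(q.eval t) = s at *
      rw [← h2]
      linear_combination h1)
  have hT : T = 2 * (l ^ 2 + q) := by
    rcases mul_eq_zero.mp hb with h | h
    · exact absurd h (mul_ne_zero two_ne_zero hl)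
    · exact (sub_eq_zero.mp h).symm
  refine ⟨hT, ?_⟩
  rw [hT] at ha
  linear_combination ha

theorem quartic_coeffs_eq_zero {c₀ c₁ c₂ c₃ c₄ : ℝ}
    (h : ∀ t : ℝ, c₀ + c₁ * t + c₂ * t ^ 2 + c₃ * t ^ 3 + c₄ * t ^ 4 = 0) :
    c₀ = 0 ∧ c₁ = 0 ∧ c₂ = 0 ∧ c₃ = 0 ∧ c₄ = 0 := by
  have h0 := h 0
  have h1 := h 1
  have h2 := h (-1)
  have h3 := h 2
  have h4 := h (-2)
  refine ⟨?_, ?_, ?_, ?_, ?_⟩ <;> linarith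

/-- The splitting of the Kippenhahn polynomial into two conics, in terms of the matrix entries. -/
theorem conditions_of_splitting {b₁ b₂ c : ℂ} {b α β γ : ℝ} (hc : c ≠ 0) (hγ : 0 < γ)
    (hdet : β ^ 2 < α * γ)
    (hT : ∀ t : ℝ, colForm b₁ 1 t + colForm b₂ 1 t + b ^ 2 =
      2 * ((c.re + t * c.im) ^ 2 + (α + 2 * β * t + γ * t ^ 2)))
    (hF : ∀ t : ℝ, colForm b₁ 1 t * colForm b₂ 1 t =
      ((c.re + t * c.im) ^ 2 - (α + 2 * β * t + γ * t ^ 2)) ^ 2) :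
    b ≠ 0 ∧ ((b₁.im = b₂.im ∧ ‖b₁‖ = ‖b₂‖) ∨ (b₁.re = 0 ∧ b₂.re = 0)) := by
  unfold colForm at hT hF
  obtain ⟨r₁, s₁⟩ := b₁
  obtain ⟨r₂, s₂⟩ := b₂
  obtain ⟨m, k⟩ := c
  simp only at hT hF
  obtain ⟨T0, T1, T2, -, -⟩ := quartic_coeffs_eq_zero
    (c₀ := r₁ ^ 2 + s₁ ^ 2 + r₂ ^ 2 + s₂ ^ 2 + b ^ 2 - 2 * m ^ 2 - 2 * α)
    (c₁ := 2 * s₁ + 2 * s₂ - 4 * m * k - 4 * β) (c₂ := 2 - 2 * k ^ 2 - 2 * γ) (c₃ := 0) (c₄ := 0)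
    (fun t => by linear_combination hT t)
  obtain ⟨F0, F1, F2, F3, F4⟩ := quartic_coeffs_eq_zero
    (c₀ := (r₁ ^ 2 + s₁ ^ 2) * (r₂ ^ 2 + s₂ ^ 2) - (m ^ 2 - α) ^ 2)
    (c₁ := (r₁ ^ 2 + s₁ ^ 2) * (2 * s₂) + (r₂ ^ 2 + s₂ ^ 2) * (2 * s₁)
      - 2 * (m ^ 2 - α) * (2 * m * k - 2 * β))
    (c₂ := (r₁ ^ 2 + s₁ ^ 2) + (r₂ ^ 2 + s₂ ^ 2) + 4 * s₁ * s₂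
      - (2 * m * k - 2 * β) ^ 2 - 2 * (m ^ 2 - α) * (k ^ 2 - γ))
    (c₃ := 2 * s₁ + 2 * s₂ - 2 * (2 * m * k - 2 * β) * (k ^ 2 - γ))
    (c₄ := 1 - (k ^ 2 - γ) ^ 2)
    (fun t => by linear_combination hF t)
  have hγk : γ = 1 - k ^ 2 := by linarith
  -- The leading coefficients give `γ = 1 - k²` and `(k² - γ)² = 1`, so the center is real.
  have hk : k = 0 := by
    have h1 : k ^ 2 * γ = 0 := by rw [hγk] at F4 ⊢; linear_combination F4 / 4
    rcases mul_eq_zero.mp h1 with h | h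
    · exact pow_eq_zero_iff two_ne_zero |>.mp h
    · exact absurd h hγ.ne'
  subst hk
  have hm : m ≠ 0 := by
    rintro rfl
    exact hc rfl
  have hγ1 : γ = 1 := by linarith
  subst hγ1
  have hβ : β = (s₁ + s₂) / 2 := by linarith
  subst hβ
  have hα : α = (r₁ ^ 2 + s₁ ^ 2 + r₂ ^ 2 + s₂ ^ 2 - (s₁ - s₂) ^ 2) / 2 + m ^ 2 := by
    linear_combination (-1 / 2 : ℝ) * F2
  have hb : b ^ 2 + (s₁ - s₂) ^ 2 = 4 * m ^ 2 := by linear_combination T0 + 2 * hα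
  subst hα
  -- The last factor is `r₁² - r₂²`; the two alternatives of the theorem come from this product.
  have hd : (s₁ - s₂) ^ 2 * ((r₁ ^ 2 + s₁ ^ 2) - (r₂ ^ 2 + s₂ ^ 2) - (s₁ ^ 2 - s₂ ^ 2)) = 0 := by
    linear_combination -(s₁ - s₂) * F1
  by_cases hs : s₁ = s₂
  · subst hs
    have hr : r₁ ^ 2 = r₂ ^ 2 := by
      have : (r₁ ^ 2 - r₂ ^ 2) ^ 2 = 0 := by linear_combination -4 * F0
      linarith [pow_eq_zero_iff two_ne_zero |>.mp this]
    refine ⟨?_, Or.inl ⟨rfl, ?_⟩⟩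
    · rintro rfl
      apply hm
      have : m ^ 2 = 0 := by linarith
      exact pow_eq_zero_iff two_ne_zero |>.mp this
    · rw [Complex.norm_def, Complex.norm_def, Complex.normSq_mk, Complex.normSq_mk]
      congr 1
      linear_combination hr
  · have hs' : (s₁ - s₂) ^ 2 ≠ 0 := pow_ne_zero 2 (sub_ne_zero.mpr hs)
    have hr : r₁ ^ 2 = r₂ ^ 2 := by
      have := (mul_eq_zero.mp hd).resolve_left hs'
      linarith
    have h0 : (s₁ - s₂) ^ 2 * r₁ ^ 2 = 0 := by
      have hr' : r₂ ^ 2 = r₁ ^ 2 := hr.symm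
      rw [hr'] at F0
      linear_combination F0
    have hr1 := (mul_eq_zero.mp h0).resolve_left hs'
    have hr2 := hr.symm.trans hr1
    refine ⟨?_, Or.inr ⟨pow_eq_zero_iff two_ne_zero |>.mp hr1,
      pow_eq_zero_iff two_ne_zero |>.mp hr2⟩⟩
    -- For `b = 0` the relations collapse to `α = β²` with `γ = 1`, against definiteness.
    rintro rfl
    rw [hr1, hr2] at hdet
    nlinarith

/-! ### Compactness of convex hulls -/

/-- By Carathéodory, `dim + 1` points suffice, so the hull is a continuous image of a simplex times
a power of `S`. -/
theorem IsCompact.convexHull_of_finiteDimensional {E : Type*} [NormedAddCommGroup E]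
    [NormedSpace ℝ E] [FiniteDimensional ℝ E] {S : Set E} (hS : IsCompact S) :
    IsCompact (convexHull ℝ S) := by
  set n := Module.finrank ℝ E + 1
  have h : convexHull ℝ S = (fun v : (Fin n → ℝ) × (Fin n → E) => ∑ i, v.1 i • v.2 i) ''
      (stdSimplex ℝ (Fin n) ×ˢ Set.univ.pi fun _ => S) := by
    apply Set.Subset.antisymm
    · intro p hp
      have hsub := Caratheodory.minCardFinsetOfMemConvexHull_subseteq hp
      have hai := Caratheodory.affineIndependent_minCardFinsetOfMemConvexHull hp
      have hmem := Caratheodory.mem_minCardFinsetOfMemConvexHull hp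
      have hne := Caratheodory.minCardFinsetOfMemConvexHull_nonempty hp
      generalize Caratheodory.minCardFinsetOfMemConvexHull hp = t at *
      have hcard : Fintype.card t ≤ Fintype.card (Fin n) := by
        rw [Fintype.card_fin]
        exact hai.card_le_finrank_succ.trans
          (Nat.succ_le_succ (Submodule.finrank_le _))
      obtain ⟨e⟩ := Function.Embedding.nonempty_of_card_le hcard
      have : Nonempty t := hne.to_subtype
      -- Pads `t` to exactly `n` points by repetition.
      set f : Fin n → E := fun i => (Function.invFun e i : t) with hf
      have hr : Set.range f = t := by
        ext x
        constructor
        · rintro ⟨i, rfl⟩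
          exact (Function.invFun e i).2
        · intro hx
          exact ⟨e ⟨x, hx⟩, by simp [hf, Function.leftInverse_invFun e.injective _]⟩
      have hL : Set.range f = Fintype.linearCombination ℝ f ''
          Set.range fun i j : Fin n => if i = j then (1 : ℝ) else 0 := by
        rw [← Set.range_comp]
        congr 1
        ext i
        simp [Fintype.linearCombination_apply]
      rw [← hr, hL, ← LinearMap.image_convexHull, convexHull_basis_eq_stdSimplex] at hmem
      obtain ⟨w, hw, rfl⟩ := hmem
      exact ⟨(w, f), ⟨hw, fun i _ => hsub (Function.invFun e i).2⟩, rfl⟩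
    · rintro _ ⟨⟨w, z⟩, ⟨hw, hz⟩, rfl⟩
      exact (convex_convexHull ℝ S).sum_mem (fun i _ => hw.1 i) hw.2
        fun i _ => subset_convexHull ℝ S (hz i trivial)
  rw [h]
  refine ((isCompact_stdSimplex ℝ _).prod (isCompact_univ_pi fun _ => hS)).image ?_
  fun_prop

/-! ### Necessity of the conditions -/

theorem colForm_smul (b : ℂ) (x t : ℝ) : colForm b x (x * t) = x ^ 2 * colForm b 1 t := by
  unfold colForm
  ring

/-- A conic with center off the origin that supports the numerical range in an open set of
directions splits off the Kippenhahn polynomial. -/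
theorem conditions_of_hasSupport {b₁ b₂ c : ℂ} {b α β γ x : ℝ} (hc : c ≠ 0) (hx : x ≠ 0)
    (hγ : 0 < γ) (hdet : β ^ 2 < α * γ) {S : Set ℝ} (hS : S.Infinite)
    (h : ∀ y ∈ S, HasSupport (numericalRange (triangularizedMatrix 0 b₁ b₂ b)) x y
      (x * c.re + y * c.im + √(α * x ^ 2 + 2 * β * x * y + γ * y ^ 2))) :
    b ≠ 0 ∧ ((b₁.im = b₂.im ∧ ‖b₁‖ = ‖b₂‖) ∨ (b₁.re = 0 ∧ b₂.re = 0)) := by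
  open Polynomial in
  set l : ℝ[X] := C (x * c.re) + C c.im * X with hl
  open Polynomial in
  set q : ℝ[X] := C γ * X ^ 2 + C (2 * β * x) * X + C (α * x ^ 2) with hq
  open Polynomial in
  set f : ℂ → ℝ[X] := fun d => C ((x * d.re) ^ 2) + (C (x * d.im) + X) ^ 2 with hf
  have el : ∀ y, l.eval y = x * c.re + y * c.im := fun y => by
    simp only [hl, Polynomial.eval_add, Polynomial.eval_mul, Polynomial.eval_C, Polynomial.eval_X]
    ring
  have eq : ∀ y, q.eval y = α * x ^ 2 + 2 * β * x * y + γ * y ^ 2 := fun y => by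
    simp [hq]; ring
  have ef : ∀ d y, (f d).eval y = colForm d x y := fun d y => by simp [hf, colForm]
  have hdeg : q.natDegree = 2 := Polynomial.natDegree_quadratic hγ.ne'
  clear_value q
  have hl0 : l ≠ 0 := by
    intro h0
    apply hc
    have h1 := el 0
    have h2 := el 1
    rw [h0] at h1 h2
    simp [hx] at h1 h2
    apply Complex.ext
    · exact h1
    · rw [h1] at h2; simpa using h2.symm
  have hpos : ∀ y, 0 < q.eval y := by
    intro y
    rw [eq]
    have h1 : 0 < (α * γ - β ^ 2) * x ^ 2 := mul_pos (by linarith) (by positivity)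
    have h2 : γ * (α * x ^ 2 + 2 * β * x * y + γ * y ^ 2) =
        (γ * y + β * x) ^ 2 + (α * γ - β ^ 2) * x ^ 2 := by ring
    have h3 : 0 < γ * (α * x ^ 2 + 2 * β * x * y + γ * y ^ 2) := by rw [h2]; positivity
    exact pos_of_mul_pos_right h3 hγ.le
  obtain ⟨hT, hF⟩ := eq_of_infinite_kippenhahn (T := f b₁ + f b₂ + Polynomial.C ((x * b) ^ 2))
    (F := f b₁ * f b₂) hl0 hdeg hpos hS (fun y hy => by
      obtain ⟨m, hm, hP⟩ := exists_hasSupport_numericalRange b₁ b₂ b x y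
      rw [hm.unique (h y hy)] at hP
      simpa only [el, eq, ef, Polynomial.eval_add, Polynomial.eval_mul, Polynomial.eval_C] using hP)
  have hx2 : x ^ 2 ≠ 0 := pow_ne_zero 2 hx
  -- Both identities are homogeneous; `y = x t` reduces them to `x = 1`.
  refine conditions_of_splitting hc hγ hdet (fun t => ?_) (fun t => ?_)
  · have := congrArg (Polynomial.eval (x * t)) hT
    simp only [el, eq, ef, Polynomial.eval_add, Polynomial.eval_mul, Polynomial.eval_pow,
      Polynomial.eval_C, Polynomial.eval_ofNat, colForm_smul] at this
    apply mul_left_cancel₀ hx2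
    linear_combination this
  · have := congrArg (Polynomial.eval (x * t)) hF
    simp only [el, eq, ef, Polynomial.eval_sub, Polynomial.eval_mul, Polynomial.eval_pow,
      colForm_smul] at this
    apply mul_left_cancel₀ (mul_ne_zero hx2 hx2)
    linear_combination this

/-- If the first of two ellipses is not swallowed by the second and has its center off the origin,
then the hull of both can be the numerical range only in the described cases. -/
theorem conditions_of_convexHull {b₁ b₂ c₁ c₂ : ℂ} {b : ℝ} {E₁ E₂ : Set ℂ}
    (h₁ : IsEllipseWithCenter E₁ c₁) (h₂ : IsEllipseWithCenter E₂ c₂) (hc : c₁ ≠ 0)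
    (hE : ¬ E₁ ⊆ convexHull ℝ E₂)
    (hW : numericalRange (triangularizedMatrix 0 b₁ b₂ b) = convexHull ℝ (E₁ ∪ E₂)) :
    b ≠ 0 ∧ ((b₁.im = b₂.im ∧ ‖b₁‖ = ‖b₂‖) ∨ (b₁.re = 0 ∧ b₂.re = 0)) := by
  obtain ⟨α, β, γ, hγ, hdet, hs₁⟩ := h₁.exists_hasSupport
  obtain ⟨α', β', γ', -, -, hs₂⟩ := h₂.exists_hasSupport
  set g₁ : ℝ × ℝ → ℝ := fun v => v.1 * c₁.re + v.2 * c₁.im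
    + √(α * v.1 ^ 2 + 2 * β * v.1 * v.2 + γ * v.2 ^ 2) with hg₁
  set g₂ : ℝ × ℝ → ℝ := fun v => v.1 * c₂.re + v.2 * c₂.im
    + √(α' * v.1 ^ 2 + 2 * β' * v.1 * v.2 + γ' * v.2 ^ 2) with hg₂
  have hopen : IsOpen {v | g₂ v < g₁ v} := isOpen_lt (by fun_prop) (by fun_prop)
  obtain ⟨x₀, y₀, h0⟩ : ∃ x y, g₂ (x, y) < g₁ (x, y) := by
    by_contra! hle
    exact hE (subset_of_hasSupport_le (convex_convexHull ℝ E₂) h₂.isCompact.convexHull_of_finiteDimensional.isClosed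
      fun x y => ⟨_, _, hs₁ x y, (hs₂ x y).convexHull, hle x y⟩)
  -- A box of directions where the first ellipse dominates leaves room for a nonzero `x` and
  -- infinitely many `y`.
  obtain ⟨U, hU, V, hV, hUV⟩ := mem_nhds_prod_iff.mp (hopen.mem_nhds h0)
  obtain ⟨x, hxU, hx⟩ : ∃ x ∈ U, x ≠ 0 :=
    ((infinite_of_mem_nhds x₀ hU).exists_notMem_finset {0}).imp fun x h => by simpa using h
  refine conditions_of_hasSupport hc hx hγ hdet (infinite_of_mem_nhds y₀ hV) (fun y hy => ?_)
  have hlt : g₂ (x, y) < g₁ (x, y) := hUV (Set.mk_mem_prod hxU hy)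
  have := ((hs₁ x y).union (hs₂ x y)).convexHull
  rwa [← hW, max_eq_left hlt.le] at this

/-! ### Sufficiency and the main theorem -/

theorem isBiElliptical_of_splitting {b₁ b₂ : ℂ} {b α β γ m : ℝ} (hm : 0 < m) (hγ : 0 < γ)
    (hdet : β ^ 2 < α * γ)
    (hT : ∀ x y : ℝ, colForm b₁ x y + colForm b₂ x y + (x * b) ^ 2 =
      2 * ((x * m) ^ 2 + (α * x ^ 2 + 2 * β * x * y + γ * y ^ 2)))
    (hF : ∀ x y : ℝ, colForm b₁ x y * colForm b₂ x y =
      ((x * m) ^ 2 - (α * x ^ 2 + 2 * β * x * y + γ * y ^ 2)) ^ 2) :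
    IsBiElliptical (numericalRange (triangularizedMatrix 0 b₁ b₂ b)) := by
  have hpos : ∀ x y : ℝ, 0 ≤ α * x ^ 2 + 2 * β * x * y + γ * y ^ 2 := by
    intro x y
    have h1 : 0 ≤ (α * γ - β ^ 2) * x ^ 2 := mul_nonneg (by linarith) (by positivity)
    have h2 : γ * (α * x ^ 2 + 2 * β * x * y + γ * y ^ 2) =
        (γ * y + β * x) ^ 2 + (α * γ - β ^ 2) * x ^ 2 := by ring
    have h3 : 0 ≤ γ * (α * x ^ 2 + 2 * β * x * y + γ * y ^ 2) := by rw [h2]; positivity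
    exact nonneg_of_mul_nonneg_right h3 hγ
  obtain ⟨E₁, hE₁, hs₁⟩ := exists_ellipse_hasSupport (m : ℂ) hγ hdet
  obtain ⟨E₂, hE₂, hs₂⟩ := exists_ellipse_hasSupport (-m : ℂ) hγ hdet
  simp only [Complex.neg_re, Complex.neg_im, Complex.ofReal_re, Complex.ofReal_im, neg_zero,
    mul_zero, add_zero, mul_neg] at hs₁ hs₂
  have hW : ∀ x y : ℝ, HasSupport (numericalRange (triangularizedMatrix 0 b₁ b₂ b)) x y
      (max (x * m + √(α * x ^ 2 + 2 * β * x * y + γ * y ^ 2))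
        (-(x * m) + √(α * x ^ 2 + 2 * β * x * y + γ * y ^ 2))) := by
    intro x y
    have hs := Real.sq_sqrt (hpos x y)
    have h0 := Real.sqrt_nonneg (α * x ^ 2 + 2 * β * x * y + γ * y ^ 2)
    have hT' := hT x y
    have hF' := hF x y
    rw [← hs] at hT' hF'
    generalize √(α * x ^ 2 + 2 * β * x * y + γ * y ^ 2) = s at *
    rw [max_add_add_right, ← abs_eq_max_neg]
    have ha := sq_abs (x * m)
    have ha0 := abs_nonneg (x * m)
    rw [← ha] at hT' hF'
    generalize |x * m| = a at *
    refine hasSupport_numericalRange (by positivity) ?_ ?_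
    · rw [hT', hF']
      ring
    · rw [hT']
      nlinarith [mul_nonneg ha0 h0]
  have hU : ∀ x y, HasSupport (convexHull ℝ (E₁ ∪ E₂)) x y _ := fun x y =>
    ((hs₁ x y).union (hs₂ x y)).convexHull
  refine ⟨E₁, E₂, m, -m, hE₁, hE₂, ?_, fun h => ?_, fun h => ?_, Set.Subset.antisymm ?_ ?_⟩
  · intro h
    have := congrArg Complex.re h
    simp only [Complex.neg_re, Complex.ofReal_re] at this
    linarith
  -- Along the real axis each ellipse reaches `2 m` beyond the other on its own side.
  · obtain ⟨w, hw, hwm⟩ := (hs₁ 1 0).1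
    have := (hs₂ 1 0).convexHull.le (h hw)
    simp only at hwm
    linarith
  · obtain ⟨w, hw, hwm⟩ := (hs₂ (-1) 0).1
    have := (hs₁ (-1) 0).convexHull.le (h hw)
    simp only at hwm
    linarith
  · exact subset_of_hasSupport_le (convex_convexHull ℝ _)
      (hE₁.isCompact.union hE₂.isCompact).convexHull_of_finiteDimensional.isClosed
      fun x y => ⟨_, _, hW x y, hU x y, le_rfl⟩
  · exact subset_of_hasSupport_le (convex_numericalRange _) (isCompact_numericalRange _).isClosed
      fun x y => ⟨_, _, hU x y, hW x y, le_rfl⟩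

theorem corollary4p2 (b₁ b₂ : ℂ) (b : ℝ) :
    IsBiElliptical (numericalRange (triangularizedMatrix 0 b₁ b₂ b)) ↔
      b ≠ 0 ∧ ((b₁.im = b₂.im ∧ ‖b₁‖ = ‖b₂‖) ∨ (b₁.re = 0 ∧ b₂.re = 0)) := by
  constructor
  · rintro ⟨E₁, E₂, c₁, c₂, h₁, h₂, hc, hn₁, hn₂, hW⟩
    -- Distinct centers cannot both be the origin.
    by_cases h0 : c₁ = 0
    · refine conditions_of_convexHull h₂ h₁ (fun h => hc (h0.trans h.symm)) hn₂ ?_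
      rw [hW, Set.union_comm]
    · exact conditions_of_convexHull h₁ h₂ h0 hn₁ hW
  · rintro ⟨hb, ⟨him, hnorm⟩ | ⟨h1, h2⟩⟩
    · have hre : b₁.re ^ 2 = b₂.re ^ 2 := by
        have h := congrArg (· ^ 2) hnorm
        simp only [← Complex.normSq_eq_norm_sq, Complex.normSq_apply, him] at h
        linarith
      have hb2 : 0 < b ^ 2 := by positivity
      -- Here and in case (ii) the witnesses solve the relations of `conditions_of_splitting`: `4 m²
      -- = b² + (Im b₁ - Im b₂)²`, `β` the mean imaginary part, `γ = 1`.
      refine isBiElliptical_of_splitting (α := b₁.re ^ 2 + b₁.im ^ 2 + b ^ 2 / 4) (β := b₁.im)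
        (γ := 1) (m := |b| / 2) (by positivity) one_pos ?_ (fun x y => ?_) (fun x y => ?_)
      · nlinarith [sq_nonneg b₁.re]
      · have := sq_abs b
        unfold colForm
        rw [← him]
        linear_combination -x ^ 2 * hre - x ^ 2 / 2 * this
      · have := sq_abs b
        have h1 : colForm b₂ x y = colForm b₁ x y := by
          unfold colForm
          rw [← him]
          linear_combination -x ^ 2 * hre
        have h2 : (x * (|b| / 2)) ^ 2 = x ^ 2 * b ^ 2 / 4 := by linear_combination x ^ 2 / 4 * this
        rw [h1, h2]
        unfold colForm
        ring
    · have hb2 : 0 < b ^ 2 := by positivity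
      have hd : 0 < (b₁.im - b₂.im) ^ 2 + b ^ 2 := by positivity
      have hs := Real.sq_sqrt hd.le
      have h3 : ∀ x, (x * (√((b₁.im - b₂.im) ^ 2 + b ^ 2) / 2)) ^ 2 =
          x ^ 2 * ((b₁.im - b₂.im) ^ 2 + b ^ 2) / 4 := by
        intro x
        linear_combination x ^ 2 / 4 * hs
      refine isBiElliptical_of_splitting (α := ((b₁.im + b₂.im) ^ 2 + b ^ 2) / 4)
        (β := (b₁.im + b₂.im) / 2) (γ := 1) (m := √((b₁.im - b₂.im) ^ 2 + b ^ 2) / 2)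
        (by positivity) one_pos ?_ (fun x y => ?_) (fun x y => ?_)
      · nlinarith
      · rw [h3]
        unfold colForm
        rw [h1, h2]
        ring
      · rw [h3]
        unfold colForm
        rw [h1, h2]
        ring
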